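/- Let $p>2$ be a prime and let $E$ be an elliptic curve over $\mathbb{F}_p$ with full level-$2$ structure, i.e. the group of points $x\in E(\mathbb{F}_p)$ with $2x=0$ is isomorphic to $(\mathbb{Z}/2\mathbb{Z})^2$. Let $\widetilde K=\operatorname{Kum}(E\times E)$ be the Kummer surface of $E\times E$, i.e. the minimal desingularization of the quotient of $E\times E$ by the involution $(x,y)\mapsto(-x,-y)$. Then the set $\widetilde K(\mathbb{F}_p)$ of $\mathbb{F}_p$-points of $\widetilde K$ is finite, and its cardinality is divisible by $8$. -/

import Mathlib

open CategoryTheory AlgebraicGeometry MonoidalCategory CartesianMonoidalCategory MonObj GrpObj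

universe u

namespace KummerSurface

/-- An elliptic curve over a field `k`: a group scheme over `k` that is a smooth, proper,
geometrically integral curve. -/
class IsEllipticCurve {k : Type u} [Field k] (E : Over (Spec (.of k))) [GrpObj E] : Prop where
  isProper : IsProper E.hom
  smooth : SmoothOfRelativeDimension 1 E.hom
  geometricallyIntegral : GeometricallyIntegral E.hom

/-- The set `X(k)` of `k`-rational points of a `k`-scheme `X`, i.e. of the sections of
`X ⟶ Spec k`. If `X` is a group scheme, this is a group (written multiplicatively). -/
abbrev RationalPoints {k : Type u} [Field k] (X : Over (Spec (.of k))) : Type u :=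
  𝟙_ (Over (Spec (.of k))) ⟶ X

/-- `E` has full level-`2` structure over `k`: there is an isomorphism of `(ℤ/2ℤ)²` onto the
group of all `k`-rational points `x` of `E` with `2x = 0`. -/
def HasFullLevelTwoStructure {k : Type u} [Field k] (E : Over (Spec (.of k))) [GrpObj E] : Prop :=
  ∃ f : Multiplicative (ZMod 2 × ZMod 2) →* RationalPoints E,
    Function.Injective f ∧ ∀ x : RationalPoints E, x ∈ Set.range f ↔ x * x = 1

/-- `q : X ⟶ Y` is the quotient of the scheme `X` by the group `{1, σ}` generated by an involution
`σ` of `X`: the morphism `q` is affine and `σ`-invariant, and `𝒪_Y ⟶ q_* 𝒪_X` identifies `𝒪_Y`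
with the subsheaf of `σ`-invariant sections. -/
structure IsInvolutionQuotient {X Y : Scheme.{u}} (σ : X ⟶ X) (q : X ⟶ Y) : Prop where
  involutive : σ ≫ σ = 𝟙 X
  isAffineHom : IsAffineHom q
  invariant : σ ≫ q = q
  injective : ∀ U : Y.Opens, Function.Injective (q.app U)
  mem_range_iff : ∀ (U : Y.Opens) (h : q ⁻¹ᵁ U ≤ σ ⁻¹ᵁ (q ⁻¹ᵁ U)) (s : Γ(X, q ⁻¹ᵁ U)),
    s ∈ Set.range (q.app U) ↔ σ.appLE (q ⁻¹ᵁ U) (q ⁻¹ᵁ U) h s = s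

/-- A desingularization of `Y`: a proper birational morphism `π : Z ⟶ Y` from an integral regular
scheme `Z`. Birational means that `π` restricts to an isomorphism over a dense open subset of `Y`
with dense preimage. -/
structure IsDesingularization {Z Y : Scheme.{u}} (π : Z ⟶ Y) : Prop where
  isIntegral : IsIntegral Z
  isRegular : ∀ z : Z, IsRegularLocalRing (Z.presheaf.stalk z)
  isProper : IsProper π
  birational : ∃ U : Y.Opens, Dense (U : Set Y) ∧ Dense ((π ⁻¹ᵁ U : Z.Opens) : Set Z) ∧
    IsIso (π ∣_ U)

/-- A minimal desingularization: every desingularization factors uniquely through it. -/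
structure IsMinimalDesingularization {Z Y : Scheme.{u}} (π : Z ⟶ Y) : Prop extends
    IsDesingularization π where
  existsUnique_fac : ∀ (Z' : Scheme.{u}) (π' : Z' ⟶ Y), IsDesingularization π' →
    ∃! f : Z' ⟶ Z, f ≫ π = π'

/-- The involution `(x, y) ↦ (-x, -y)` of `E × E`. -/
noncomputable def negation {k : Type u} [Field k] (E : Over (Spec (.of k))) [GrpObj E] :
    E ⊗ E ⟶ E ⊗ E :=
  ι[E] ⊗ₘ ι[E]

/-- `K` is the Kummer surface of `E × E`, i.e. the minimal desingularization of the quotient `K₀` of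
`E × E` by the involution `(x, y) ↦ (-x, -y)`. All morphisms are morphisms over `k`; the quotient
and the minimal desingularization are unique up to unique isomorphism. -/
def IsKummerSurface {k : Type u} [Field k] (E : Over (Spec (.of k))) [GrpObj E]
    (K : Over (Spec (.of k))) : Prop :=
  ∃ (K₀ : Over (Spec (.of k))) (q : E ⊗ E ⟶ K₀) (π : K ⟶ K₀),
    IsInvolutionQuotient (negation E).left q.left ∧ IsMinimalDesingularization π.left

end KummerSurface

/-! The group `G` of pairs of rational `2`-torsion points has order `16` and acts on `E × E` by
translations commuting with negation. The action descends to the quotient (`exists_comp_eq`) and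
lifts to `K` by the universal property of the minimal desingularization (`exists_lift_action`). If
`g` fixes a rational point `s` of `K`, lift the image of `s` in the quotient to a point `x` of `E ×
E` over some extension field. Fibres of the quotient are orbits of the involution (`eq_or_eq_comp`),
so `x + g = x` or `x + g = -x`. The first forces `g = 0` and the second determines `g`. Stabilizers
thus have order at most `2`, and every orbit has `8` or `16` elements. -/

/-! ### Descent of morphisms along quotient maps -/

namespace AlgebraicGeometry

open TopologicalSpace Opposite

/-- A surjective morphism of schemes that is injective on sections is an epimorphism. -/
lemma epi_of_surjective_of_app_injective {X Y : Scheme.{u}} (q : X ⟶ Y) [Surjective q]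
    (hq : ∀ U : Y.Opens, Function.Injective (q.app U)) : Epi q where
  left_cancellation {Z} f g h := by
    have hb : f.base = g.base := by
      ext y
      obtain ⟨x, rfl⟩ := q.surjective y
      simpa using congr($(h) x)
    refine Scheme.Hom.ext hb fun U ↦ ?_
    have hm (U : Y.Opens) : Mono (q.app U) := ConcreteCategory.mono_of_injective _ (hq U)
    rw [← cancel_mono (q.app _)]
    have h1 := Scheme.Hom.congr_app h U
    simp only [Scheme.Hom.comp_app, Category.assoc, q.naturality] at h1 ⊢
    rw [reassoc_of% h1]
    refine (Category.assoc _ _ _).trans ?_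
    refine (congrArg (_ ≫ ·) (X.presheaf.map_comp _ _).symm).trans ?_
    convert! Category.comp_id _
    exact X.presheaf.map_id _

/-- Descent of morphisms along a topological quotient map that is injective on sections. -/
lemma exists_comp_eq_of_isQuotientMap {X Y Z : Scheme.{u}} (q : X ⟶ Y)
    (hquot : Topology.IsQuotientMap q) (hinj : ∀ U : Y.Opens, Function.Injective (q.app U))
    (f : X ⟶ Z) (hfib : ∀ x y, q x = q y → f x = f y)
    (hr : ∀ (V : Z.Opens) (U : Y.Opens) (e : q ⁻¹ᵁ U ≤ f ⁻¹ᵁ V) (s : Γ(Z, V)),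
      f.appLE V (q ⁻¹ᵁ U) e s ∈ Set.range (q.app U)) : ∃ g : Y ⟶ Z, q ≫ g = f := by
  let b : C(Y, Z) := Topology.IsQuotientMap.lift (f := q.base.hom) hquot f.base.hom
    (fun x y h ↦ hfib x y h)
  have hb (x : X) : b (q x) = f x := congr($(Topology.IsQuotientMap.lift_comp
    (f := q.base.hom) hquot f.base.hom (fun x y h ↦ hfib x y h)) x)
  let b' : Y.toTopCat ⟶ Z.toTopCat := TopCat.ofHom b
  have hle (V : Z.Opens) : q ⁻¹ᵁ ((Opens.map b').obj V) ≤ f ⁻¹ᵁ V := fun x hx ↦ by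
    have hx' : b (q x) ∈ V := hx
    rwa [hb] at hx'
  choose φ hφ using fun (V : Z.Opens) (s : Γ(Z, V)) ↦ hr V ((Opens.map b').obj V) (hle V) s
  let Φ (V : Z.Opens) : Γ(Z, V) ⟶ Γ(Y, (Opens.map b').obj V) := CommRingCat.ofHom
    { toFun := φ V
      -- Preimages under `q.app` are unique, so the chosen ones respect the ring operations.
      map_one' := hinj _ (by rw [hφ, map_one, map_one])
      map_mul' := fun s t ↦ hinj _ (by rw [hφ, map_mul, map_mul, hφ, hφ])
      map_zero' := hinj _ (by rw [hφ, map_zero, map_zero])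
      map_add' := fun s t ↦ hinj _ (by rw [hφ, map_add, map_add, hφ, hφ]) }
  have hΦ (V : Z.Opens) : Φ V ≫ q.app _ = f.appLE V _ (hle V) := by
    ext s
    exact hφ V s
  have hm (U : Y.Opens) : Mono (q.app U) := ConcreteCategory.mono_of_injective _ (hinj U)
  let g : Y.toPresheafedSpace ⟶ Z.toPresheafedSpace :=
    { base := b'
      c :=
        { app := fun V ↦ Φ V.unop
          naturality := by
            intro V W i
            refine (cancel_mono (q.app ((Opens.map b').obj W.unop))).1 ?_
            refine (Category.assoc _ _ _).trans ?_
            rw [hΦ]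
            refine ((Category.assoc _ _ _).trans ?_).symm
            refine (congrArg (Φ V.unop ≫ ·)
              (q.naturality ((Opens.map b').map i.unop).op)).trans ?_
            rw [reassoc_of% hΦ, Scheme.Hom.appLE_map]
            exact (Scheme.Hom.map_appLE f _ i).symm } }
  have hg : q.toPshHom ≫ g = f.toPshHom := by
    refine PresheafedSpace.ext _ _ (by ext x; exact hb x) ?_
    refine NatTrans.ext (funext fun V ↦ ?_)
    dsimp
    refine (congrArg (· ≫ _) (hΦ V.unop)).trans ?_
    refine (Scheme.Hom.appLE_map f (V' := (Opens.map f.base).obj V.unop) (hle V.unop) _).trans ?_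
    exact f.appLE_eq_app
  refine ⟨⟨⟨g, fun y ↦ ?_⟩⟩, ?_⟩
  · obtain ⟨x, rfl⟩ := hquot.surjective y
    -- If a composite of ring maps is local, so is its first factor; here the composite is the stalk
    -- map of `f`.
    have h1 : IsLocalHom ((q.toPshHom ≫ g).stalkMap x).hom := by
      rw [hg]
      exact f.prop x
    rw [PresheafedSpace.stalkMap.comp] at h1
    exact @isLocalHom_of_comp _ _ _ _ _ _ _ _ h1
  · apply Scheme.Hom.ext'
    apply LocallyRingedSpace.Hom.ext'
    exact hg

end AlgebraicGeometry

namespace AlgebraicGeometry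

/-- Morphisms from an affine scheme into a common affine open of the target are determined by
their action on sections. -/
lemma eq_of_appLE_top_eq {W X : Scheme.{u}} [IsAffine W] {V : X.Opens} (hV : IsAffineOpen V)
    {a b : W ⟶ X} (ha : ⊤ ≤ a ⁻¹ᵁ V) (hb : ⊤ ≤ b ⁻¹ᵁ V)
    (h : a.appLE V ⊤ ha = b.appLE V ⊤ hb) : a = b := by
  have h1 := IsAffineOpen.SpecMap_appLE_fromSpec a hV (isAffineOpen_top W) ha
  rw [h, IsAffineOpen.SpecMap_appLE_fromSpec b hV (isAffineOpen_top W) hb] at h1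
  have : IsIso (isAffineOpen_top W).fromSpec := by
    rw [IsAffineOpen.fromSpec_top]
    infer_instance
  exact ((cancel_epi _).1 h1).symm

end AlgebraicGeometry

/-! ### Quotients by an involution -/

namespace KummerSurface.IsInvolutionQuotient

variable {X Y : Scheme.{u}} {σ : X ⟶ X} {q : X ⟶ Y}

lemma preimage_preimage (h : IsInvolutionQuotient σ q) (U : Y.Opens) :
    σ ⁻¹ᵁ (q ⁻¹ᵁ U) = q ⁻¹ᵁ U := by
  rw [← Scheme.Hom.comp_preimage, h.invariant]

lemma le_preimage (h : IsInvolutionQuotient σ q) (U : Y.Opens) :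
    q ⁻¹ᵁ U ≤ σ ⁻¹ᵁ (q ⁻¹ᵁ U) := (h.preimage_preimage U).ge

lemma appLE_appLE (h : IsInvolutionQuotient σ q) (U : Y.Opens) (s : Γ(X, q ⁻¹ᵁ U)) :
    σ.appLE _ _ (h.le_preimage U) (σ.appLE _ _ (h.le_preimage U) s) = s := by
  rw [← CommRingCat.comp_apply, Scheme.Hom.appLE_comp_appLE]
  simp only [h.involutive]
  rw [Scheme.Hom.appLE, Scheme.Hom.id_app]
  exact congr($((Category.id_comp _).trans (X.presheaf.map_id _)) s)

lemma exists_app_eq_add (h : IsInvolutionQuotient σ q) (U : Y.Opens) (s : Γ(X, q ⁻¹ᵁ U)) :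
    ∃ t, q.app U t = s + σ.appLE _ _ (h.le_preimage U) s :=
  (h.mem_range_iff U (h.le_preimage U) _).2 <| by
    rw [map_add, h.appLE_appLE, add_comm]

lemma exists_app_eq_mul (h : IsInvolutionQuotient σ q) (U : Y.Opens) (s : Γ(X, q ⁻¹ᵁ U)) :
    ∃ t, q.app U t = s * σ.appLE _ _ (h.le_preimage U) s :=
  (h.mem_range_iff U (h.le_preimage U) _).2 <| by
    rw [map_mul, h.appLE_appLE, mul_comm]

/-- A section `s` is a root of `(X - s)(X - σs)`, whose coefficients are invariant. -/
lemma isIntegralHom (h : IsInvolutionQuotient σ q) : IsIntegralHom q := by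
  refine (isIntegralHom_iff q).2 ⟨h.isAffineHom, fun U _ s ↦ ?_⟩
  obtain ⟨a, ha⟩ := h.exists_app_eq_add U s
  obtain ⟨b, hb⟩ := h.exists_app_eq_mul U s
  refine ⟨Polynomial.X ^ 2 - Polynomial.C a * Polynomial.X + Polynomial.C b, by monicity!, ?_⟩
  have ha' : (q.app U).hom a = _ := ha
  have hb' : (q.app U).hom b = _ := hb
  simp only [Polynomial.eval₂_add, Polynomial.eval₂_sub, Polynomial.eval₂_mul,
    Polynomial.eval₂_C, Polynomial.eval₂_X, Polynomial.eval₂_pow]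
  rw [ha', hb']
  ring

/-- The image is closed by integrality. It is dense, since a nonempty open set missing it would have
its nonzero ring of sections embedded in the zero ring. -/
lemma surjective (h : IsInvolutionQuotient σ q) : Surjective q := by
  have := h.isIntegralHom
  have : IsDominant q := by
    refine ⟨dense_iff_inter_open.2 fun V hV ⟨y, hy⟩ ↦ ?_⟩
    by_contra hne
    let U : Y.Opens := ⟨V, hV⟩
    have hbot : q ⁻¹ᵁ U = ⊥ := by
      ext x
      exact ⟨fun hx ↦ (hne ⟨q x, hx, x, rfl⟩).elim, fun hx ↦ hx.elim⟩
    have : Subsingleton Γ(X, q ⁻¹ᵁ U) := by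
      rw [hbot]
      infer_instance
    have : Nonempty U := ⟨⟨y, hy⟩⟩
    exact not_subsingleton Γ(Y, U) (h.injective U).subsingleton
  exact surjective_of_isDominant_of_isClosed_range q q.isClosedMap.isClosed_range

lemma isQuotientMap (h : IsInvolutionQuotient σ q) : Topology.IsQuotientMap q := by
  have := h.isIntegralHom
  have := h.surjective
  exact q.isClosedMap.isQuotientMap q.continuous q.surjective

lemma epi (h : IsInvolutionQuotient σ q) : Epi q :=
  have := h.surjective
  epi_of_surjective_of_app_injective q h.injective

/-- The fibres of an involution quotient on points with values in a field are the orbits of the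
involution. -/
lemma eq_or_eq_comp (h : IsInvolutionQuotient σ q) {L : Type u} [Field L]
    {a b : Spec (.of L) ⟶ X} (hab : a ≫ q = b ≫ q) : b = a ∨ b = a ≫ σ := by
  have := h.isAffineHom
  obtain ⟨U, hU, hy, -⟩ := exists_isAffineOpen_mem_and_subset
    (x := (a ≫ q) default) (U := ⊤) trivial
  have hV : IsAffineOpen (q ⁻¹ᵁ U) := hU.preimage q
  have key {c : Spec (.of L) ⟶ X} (hc : a ≫ q = c ≫ q) : ⊤ ≤ c ⁻¹ᵁ (q ⁻¹ᵁ U) := fun x _ ↦ by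
    obtain rfl := Subsingleton.elim x default
    rw [hc] at hy
    exact hy
  have hc : a ≫ q = (a ≫ σ) ≫ q := by rw [Category.assoc, h.invariant]
  have hf (s : Γ(X, q ⁻¹ᵁ U)) : (a ≫ σ).appLE (q ⁻¹ᵁ U) ⊤ (key hc) s =
      a.appLE (q ⁻¹ᵁ U) ⊤ (key rfl) (σ.appLE _ _ (h.le_preimage U) s) := by
    rw [← CommRingCat.comp_apply, Scheme.Hom.appLE_comp_appLE]
  have hq (t : Γ(Y, U)) : a.appLE (q ⁻¹ᵁ U) ⊤ (key rfl) (q.app U t) =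
      b.appLE (q ⁻¹ᵁ U) ⊤ (key hab) (q.app U t) := by
    rw [Scheme.Hom.app_eq_appLE, ← CommRingCat.comp_apply, ← CommRingCat.comp_apply,
      Scheme.Hom.appLE_comp_appLE, Scheme.Hom.appLE_comp_appLE]
    simp only [hab]
  have hfield : IsDomain Γ(Spec (.of L), ⊤) :=
    (Scheme.ΓSpecIso (.of L)).commRingCatIsoToRingEquiv.toMulEquiv.isDomain _
  let f := (a.appLE (q ⁻¹ᵁ U) ⊤ (key rfl)).hom
  let f' := ((a ≫ σ).appLE (q ⁻¹ᵁ U) ⊤ (key hc)).hom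
  let g := (b.appLE (q ⁻¹ᵁ U) ⊤ (key hab)).hom
  have hprod (s : Γ(X, q ⁻¹ᵁ U)) : g s = f s ∨ g s = f' s := by
    obtain ⟨t₁, ht₁⟩ := h.exists_app_eq_add U s
    obtain ⟨t₂, ht₂⟩ := h.exists_app_eq_mul U s
    have e₁ := hq t₁
    have e₂ := hq t₂
    rw [ht₁, map_add, map_add, ← hf] at e₁
    rw [ht₂, map_mul, map_mul, ← hf] at e₂
    change f s + f' s = g s + _ at e₁
    change f s * f' s = g s * _ at e₂
    -- Equal sums and products give `(g s - f s) * (g s - f' s) = 0` in a domain.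
    rw [← sub_eq_zero, ← sub_eq_zero (b := f' s), ← mul_eq_zero]
    linear_combination e₂ - (g s) * e₁
  -- A group is not the union of two proper subgroups, here the equalizers of `g` with `f` and `f'`.
  have hall : (∀ s, g s = f s) ∨ ∀ s, g s = f' s := by
    by_contra! hcon
    obtain ⟨⟨s, hs⟩, t, ht⟩ := hcon
    have hs' := (hprod s).resolve_left hs
    have ht' := (hprod t).resolve_right ht
    rcases hprod (s + t) with e | e <;> rw [map_add, map_add] at e
    · rw [ht'] at e
      exact hs (add_right_cancel e)
    · rw [hs'] at e
      exact ht (add_left_cancel e)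
  exact hall.imp (fun e ↦ eq_of_appLE_top_eq hV (key hab) (key rfl) (by ext s; exact e s))
    (fun e ↦ eq_of_appLE_top_eq hV (key hab) (key hc) (by ext s; exact e s))

/-- A point of the fibre product of `q` with itself over `(x, y)` supplies a common residue field,
reducing to `eq_or_eq_comp`. -/
lemma eq_or_eq_apply (h : IsInvolutionQuotient σ q) {x y : X} (hxy : q x = q y) :
    y = x ∨ y = σ x := by
  obtain ⟨z, rfl, rfl⟩ := Scheme.Pullback.exists_preimage_pullback x y hxy
  let P := Limits.pullback q q
  let pt : Spec (P.residueField z) := default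
  have := h.eq_or_eq_comp (L := P.residueField z)
    (a := P.fromSpecResidueField z ≫ Limits.pullback.fst q q)
    (b := P.fromSpecResidueField z ≫ Limits.pullback.snd q q)
    (by simp [Limits.pullback.condition])
  refine this.imp (fun e ↦ ?_) (fun e ↦ ?_)
  · have := congr($(e) pt)
    rw [Scheme.Hom.comp_apply, Scheme.Hom.comp_apply, Scheme.fromSpecResidueField_apply] at this
    exact this
  · have := congr($(e) pt)
    rw [Scheme.Hom.comp_apply, Scheme.Hom.comp_apply, Scheme.Hom.comp_apply,
      Scheme.fromSpecResidueField_apply] at this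
    exact this

/-- An involution quotient is a categorical quotient. -/
lemma exists_comp_eq (h : IsInvolutionQuotient σ q) {Z : Scheme.{u}} {f : X ⟶ Z}
    (hf : σ ≫ f = f) : ∃ g : Y ⟶ Z, q ≫ g = f := by
  refine exists_comp_eq_of_isQuotientMap q h.isQuotientMap h.injective f (fun x y hxy ↦ ?_)
    fun V U e s ↦ (h.mem_range_iff U (h.le_preimage U) _).2 ?_
  · rcases h.eq_or_eq_apply hxy with rfl | rfl
    · rfl
    · rw [← Scheme.Hom.comp_apply, hf]
  · rw [← CommRingCat.comp_apply, Scheme.Hom.appLE_comp_appLE]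
    simp only [hf]

end KummerSurface.IsInvolutionQuotient

/-! ### Finiteness of the set of rational points -/

lemma RingHom.FiniteType.finite_ringHom {S R F : Type*} [CommRing S] [CommRing R] [CommRing F]
    [_root_.Finite S] [_root_.Finite F] {φ : S →+* R} (hφ : φ.FiniteType) : _root_.Finite (R →+* F) := by
  algebraize [φ]
  obtain ⟨t, ht⟩ := Algebra.FiniteType.out (R := S) (A := R)
  refine _root_.Finite.of_injective (β := (S → F) × (t → F))
    (fun g ↦ (fun s ↦ g (φ s), fun x ↦ g x)) fun g₁ g₂ h ↦ ?_
  obtain ⟨h₁, h₂⟩ := Prod.ext_iff.1 h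
  have : (⊤ : Subalgebra S R).toSubring ≤ RingHom.eqLocus g₁ g₂ := by
    rw [← ht, Algebra.adjoin_eq_ring_closure, Subring.closure_le]
    rintro x (⟨s, rfl⟩ | hx)
    · exact congr($h₁ s)
    · exact congr($h₂ ⟨x, hx⟩)
  exact RingHom.ext fun x ↦ this (Algebra.mem_top (R := S) (x := x))

namespace KummerSurface

/-- A scheme of finite type over a finite field has finitely many rational points. -/
lemma finite_rationalPoints {k : Type u} [Field k] [Finite k] (X : Over (Spec (.of k)))
    [LocallyOfFiniteType X.hom] [QuasiCompact X.hom] : Finite (RationalPoints X) := by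
  have hcpt : CompactSpace X.left := QuasiCompact.compactSpace_of_compactSpace X.hom
  have hΓ : Finite Γ(Spec (.of k), ⊤) :=
    Finite.of_equiv k (Scheme.ΓSpecIso (.of k)).commRingCatIsoToRingEquiv.symm.toEquiv
  choose U hU hxU hle using fun x : X.left ↦
    exists_isAffineOpen_mem_and_subset (x := x) (U := ⊤) trivial
  obtain ⟨t, ht⟩ := isCompact_univ.elim_finite_subcover (fun x ↦ (U x : Set X.left))
    (fun x ↦ (U x).isOpen) fun x _ ↦ Set.mem_iUnion.2 ⟨x, hxU x⟩
  have hfin (x : X.left) : Finite (Γ(X.left, U x) →+* Γ(Spec (.of k), ⊤)) :=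
    RingHom.FiniteType.finite_ringHom (HasRingHomProperty.appLE @LocallyOfFiniteType X.hom
      inferInstance ⟨⊤, isAffineOpen_top _⟩ ⟨U x, hU x⟩ le_top)
  have hmem (s : RationalPoints X) : ∃ x : t, ⊤ ≤ s.left ⁻¹ᵁ U x := by
    obtain ⟨x, hx, h⟩ := Set.mem_iUnion₂.1 (ht (Set.mem_univ (s.left (default : Spec (.of k)))))
    refine ⟨⟨x, hx⟩, fun y _ ↦ ?_⟩
    obtain rfl : y = (default : Spec (.of k)) := Subsingleton.elim (α := Spec (.of k)) _ _
    exact h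
  choose i hi using hmem
  refine Finite.of_injective (β := Σ x : t, (Γ(X.left, U x) →+* Γ(Spec (.of k), ⊤)))
    (fun s ↦ ⟨i s, (s.left.appLE _ ⊤ (hi s)).hom⟩) fun s₁ s₂ h ↦ ?_
  obtain ⟨h₁, h₂⟩ := Sigma.mk.inj_iff.1 h
  have h₃ : ⊤ ≤ s₂.left ⁻¹ᵁ U (i s₁) := h₁ ▸ hi s₂
  have h₄ : (s₁.left.appLE _ ⊤ (hi s₁)).hom = (s₂.left.appLE _ ⊤ h₃).hom := by
    refine eq_of_heq (h₂.trans ?_)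
    clear h₂
    revert h₃
    generalize hi s₂ = e
    revert e
    rw [← h₁]
    exact fun _ _ ↦ HEq.rfl
  ext1
  exact eq_of_appLE_top_eq (W := Spec (.of k)) (hU _) (hi s₁) h₃ (CommRingCat.hom_ext h₄)

/-- This is the Artin–Tate lemma: the sections upstairs are of finite type over the base and
integral, hence finite, over the sections of the quotient. -/
lemma IsInvolutionQuotient.locallyOfFiniteType {X Y S : Scheme.{u}} {σ : X ⟶ X} {q : X ⟶ Y}
    (h : IsInvolutionQuotient σ q) (f : Y ⟶ S) [IsLocallyNoetherian S]
    [hf : LocallyOfFiniteType (q ≫ f)] : LocallyOfFiniteType f := by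
  have := h.isIntegralHom
  rw [HasRingHomProperty.iff_appLE (P := @LocallyOfFiniteType)] at hf ⊢
  intro V U e
  have h₁ := hf V ⟨q ⁻¹ᵁ U, U.2.preimage q⟩ (q.preimage_mono e)
  have h₂ := IsIntegralHom.isIntegral_app (f := q) U.1 U.2
  have h₃ : (f.appLE V U e ≫ q.app U) = (q ≫ f).appLE V (q ⁻¹ᵁ U) (q.preimage_mono e) := by
    rw [Scheme.Hom.app_eq_appLE, Scheme.Hom.appLE_comp_appLE]
  rw [← h₃, CommRingCat.hom_comp] at h₁
  have hN : IsNoetherianRing Γ(S, V) := IsLocallyNoetherian.component_noetherian V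
  have hinj : Function.Injective (q.app U).hom := h.injective U
  generalize (q.app U).hom = ψ at *
  generalize (f.appLE V U e).hom = φ at *
  algebraize [φ, ψ, ψ.comp φ]
  have : Algebra.FiniteType Γ(Y, U) Γ(X, q ⁻¹ᵁ U) := .of_restrictScalars_finiteType Γ(S, V) _ _
  have : Module.Finite Γ(Y, U) Γ(X, q ⁻¹ᵁ U) := Algebra.IsIntegral.finite
  exact ⟨fg_of_fg_of_fg Γ(S, V) Γ(Y, U) Γ(X, q ⁻¹ᵁ U) Algebra.FiniteType.out
    Module.Finite.fg_top hinj⟩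

lemma IsInvolutionQuotient.quasiCompact {X Y S : Scheme.{u}} {σ : X ⟶ X} {q : X ⟶ Y}
    (h : IsInvolutionQuotient σ q) (f : Y ⟶ S) [QuasiCompact (q ≫ f)] : QuasiCompact f :=
  have := h.surjective
  ⟨fun V hV hc ↦ by
    rw [← Set.image_preimage_eq (f ⁻¹' V) q.surjective, ← Set.preimage_comp]
    exact (QuasiCompact.isCompact_preimage (f := q ≫ f) V hV hc).image q.continuous⟩

end KummerSurface

lemma MulAction.dvd_natCard_of_forall_orbit {G X : Type*} [Group G] [MulAction G X] [Finite X]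
    {n : ℕ} (h : ∀ x : X, n ∣ Nat.card (MulAction.orbit G x)) : n ∣ Nat.card X := by
  classical
  have := Fintype.ofFinite (MulAction.orbitRel.Quotient G X)
  rw [Nat.card_congr (MulAction.selfEquivSigmaOrbits G X), Nat.card_sigma]
  exact Finset.dvd_sum fun _ _ ↦ h _

/-! ### Lifting group actions to the minimal desingularization -/

namespace KummerSurface

lemma IsDesingularization.comp_isIso {Z Y Y' : Scheme.{u}} {π : Z ⟶ Y} (h : IsDesingularization π)
    (e : Y ⟶ Y') [IsIso e] : IsDesingularization (π ≫ e) where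
  isIntegral := h.isIntegral
  isRegular := h.isRegular
  isProper := have := h.isProper; inferInstance
  birational := by
    obtain ⟨U, hU, hπU, hiso⟩ := h.birational
    obtain ⟨V, rfl⟩ : ∃ V, U = e ⁻¹ᵁ V :=
      ⟨inv e ⁻¹ᵁ U, by rw [← Scheme.Hom.comp_preimage, IsIso.hom_inv_id, Scheme.Hom.id_preimage]⟩
    refine ⟨V, ?_, hπU, ?_⟩
    · have h1 := e.surjective.denseRange.dense_image e.continuous hU
      refine h1.mono ?_
      rintro _ ⟨x, hx, rfl⟩
      exact hx
    · rw [morphismRestrict_comp]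
      exact IsIso.comp_isIso' hiso inferInstance

/-- A group acting on `X` through automorphisms commuting with the involution acts compatibly on
the quotient of `X` by the involution and on the minimal desingularization of the quotient. -/
lemma exists_lift_action {X Y K : Scheme.{u}} {σ : X ⟶ X} {q : X ⟶ Y} {π : K ⟶ Y}
    (hq : IsInvolutionQuotient σ q) (hπ : IsMinimalDesingularization π) {G : Type*} [Group G]
    (T : G → (X ⟶ X)) (T_one : T 1 = 𝟙 X) (T_mul : ∀ g h, T (g * h) = T g ≫ T h)
    (T_comm : ∀ g, σ ≫ T g = T g ≫ σ) :
    ∃ (T₀ : G → (Y ⟶ Y)) (T' : G → (K ⟶ K)), (∀ g, q ≫ T₀ g = T g ≫ q) ∧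
      (∀ g, T' g ≫ π = π ≫ T₀ g) ∧ T' 1 = 𝟙 K ∧ ∀ g h, T' (g * h) = T' g ≫ T' h := by
  have := hq.epi
  have hex (g : G) : ∃ t : Y ⟶ Y, q ≫ t = T g ≫ q :=
    hq.exists_comp_eq (by rw [← Category.assoc, T_comm, Category.assoc, hq.invariant])
  choose T₀ hT₀ using hex
  have T₀_one : T₀ 1 = 𝟙 Y := by
    rw [← cancel_epi q, hT₀, T_one, Category.id_comp, Category.comp_id]
  have T₀_mul (g h : G) : T₀ (g * h) = T₀ g ≫ T₀ h := by
    rw [← cancel_epi q, hT₀, T_mul, reassoc_of% hT₀, hT₀, Category.assoc]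
  have hiso (g : G) : IsIso (T₀ g) :=
    ⟨T₀ g⁻¹, by rw [← T₀_mul, mul_inv_cancel, T₀_one], by rw [← T₀_mul, inv_mul_cancel, T₀_one]⟩
  -- Following `π` by an automorphism of `Y` gives another desingularization; uniqueness of its
  -- factorization yields the group laws.
  have hex' (g : G) := hπ.existsUnique_fac K (π ≫ T₀ g) (hπ.toIsDesingularization.comp_isIso _)
  choose T' hT' hu using hex'
  replace hT' (g : G) : T' g ≫ π = π ≫ T₀ g := hT' g
  refine ⟨T₀, T', hT₀, hT', (hu 1 (𝟙 K) (by simp [T₀_one])).symm, fun g h ↦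
    (hu _ _ ?_).symm⟩
  simp only [Category.assoc, hT', T₀_mul]
  rw [reassoc_of% hT']

/-! ### Translations and lifts of rational points -/

variable {k : Type u} [Field k]

/-- Translation by a rational point. -/
noncomputable def translation (E : Over (Spec (.of k))) [GrpObj E] (a : RationalPoints E) : E ⟶ E :=
  (toUnit E ≫ a) * 𝟙 E

section translation

variable {E : Over (Spec (.of k))} [GrpObj E]

lemma comp_translation {W : Over (Spec (.of k))} (x : W ⟶ E) (a : RationalPoints E) :
    x ≫ translation E a = (toUnit W ≫ a) * x := by
  rw [translation, comp_mul, Category.comp_id, comp_toUnit_assoc]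

lemma translation_one : translation E 1 = 𝟙 E := by
  rw [translation, comp_one, _root_.one_mul]

lemma translation_mul [IsCommMonObj E] (a b : RationalPoints E) :
    translation E (a * b) = translation E a ≫ translation E b := by
  rw [comp_translation, translation, translation, comp_mul, ← _root_.mul_assoc,
    mul_comm (toUnit E ≫ a)]

lemma inv_comp_translation [IsCommMonObj E] {a : RationalPoints E} (ha : a * a = 1) :
    ι[E] ≫ translation E a = translation E a ≫ ι[E] := by
  have h : (toUnit E ≫ a)⁻¹ = toUnit E ≫ a := by
    rw [inv_eq_iff_mul_eq_one, ← comp_mul, ha, comp_one]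
  rw [comp_translation, ← Hom.inv_def, translation, inv_eq_inv,
    _root_.mul_inv_rev, h, mul_comm]

end translation

/-- A rational point of the quotient need not lift rationally, so `L` is a residue field of its
fibre. -/
lemma IsInvolutionQuotient.exists_over {X Y : Over (Spec (.of k))} {σ : X ⟶ X} {q : X ⟶ Y}
    (h : IsInvolutionQuotient σ.left q.left) (y : RationalPoints Y) :
    ∃ (L : Type u) (_ : Field L) (s : Spec (.of L) ⟶ Spec (.of k)) (x : Over.mk s ⟶ X),
      x ≫ q = toUnit _ ≫ y := by
  have := h.surjective
  obtain ⟨x₀, hx₀⟩ := q.left.surjective (y.left (default : Spec (.of k)))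
  obtain ⟨z, -, -⟩ := Scheme.Pullback.exists_preimage_pullback (f := q.left) (g := y.left)
    x₀ (default : Spec (.of k)) hx₀
  let P := Limits.pullback q.left y.left
  refine ⟨P.residueField z, inferInstance,
    P.fromSpecResidueField z ≫ Limits.pullback.snd q.left y.left,
    Over.homMk (P.fromSpecResidueField z ≫ Limits.pullback.fst q.left y.left) ?_, ?_⟩
  · have h1 : q.left ≫ Y.hom = X.hom := Over.w q
    have h2 : y.left ≫ Y.hom = 𝟙 _ := Over.w y
    dsimp
    rw [← h1, Category.assoc, Limits.pullback.condition_assoc, h2]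
    erw [Category.comp_id]
  · ext1
    simp [P, Limits.pullback.condition]

/-- Flat surjective morphisms of this kind are epimorphisms, so rational points can be compared
after extension to `L`. -/
instance epi_toUnit {L : Type u} [Field L] (s : Spec (.of L) ⟶ Spec (.of k)) :
    Epi (toUnit (Over.mk s)) := by
  have : Surjective s := ⟨Function.surjective_to_subsingleton (β := Spec (.of k)) _⟩
  have : Epi (toUnit (Over.mk s)).left := by
    have : (toUnit (Over.mk s)).left = s := by simp
    rw [this]
    exact Flat.epi_of_flat_of_surjective s
  exact Over.epi_of_epi_left _

end KummerSurface

lemma MulAction.eight_dvd_natCard_orbit {G X : Type*} [Group G] [MulAction G X]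
    (hG : Nat.card G = 16) (x : X) (hx : Nat.card (MulAction.stabilizer G x) ≤ 2) :
    8 ∣ Nat.card (MulAction.orbit G x) := by
  have h := Nat.card_congr (MulAction.orbitProdStabilizerEquivGroup G x)
  rw [Nat.card_prod, hG] at h
  interval_cases hn : Nat.card (MulAction.stabilizer G x) <;> omega

/-! ### Stabilizers and the orbit count -/

namespace KummerSurface

variable {k : Type u} [Field k]

lemma isProper_tensorObj (E : Over (Spec (.of k))) [GrpObj E] [IsProper E.hom] :
    IsProper (E ⊗ E).hom := by
  dsimp
  infer_instance

/-- Translation of `E × E` by a pair of rational points. -/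
noncomputable def translationPair (E : Over (Spec (.of k))) [GrpObj E]
    (g : RationalPoints E × RationalPoints E) : E ⊗ E ⟶ E ⊗ E :=
  translation E g.1 ⊗ₘ translation E g.2

section translationPair

variable {E : Over (Spec (.of k))} [GrpObj E]

lemma translationPair_one : translationPair E 1 = 𝟙 (E ⊗ E) := by
  simp [translationPair, translation_one]

lemma translationPair_mul [IsCommMonObj E] (g h : RationalPoints E × RationalPoints E) :
    translationPair E (g * h) = translationPair E g ≫ translationPair E h := by
  simp [translationPair, translation_mul]

lemma negation_comp_translationPair [IsCommMonObj E] {g : RationalPoints E × RationalPoints E}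
    (hg : g * g = 1) : negation E ≫ translationPair E g = translationPair E g ≫ negation E := by
  obtain ⟨h₁, h₂⟩ := Prod.ext_iff.1 hg
  simp only [translationPair, negation, tensorHom_comp_tensorHom]
  rw [inv_comp_translation h₁, inv_comp_translation h₂]

lemma eq_one_of_comp_translationPair_eq {W : Over (Spec (.of k))} [Epi (toUnit W)]
    {x : W ⟶ E ⊗ E} {g : RationalPoints E × RationalPoints E}
    (h : x ≫ translationPair E g = x) : g = 1 := by
  have key {a : RationalPoints E} {z : W ⟶ E} (h : z ≫ translation E a = z) : a = 1 := by
    rw [comp_translation, mul_eq_right, ← comp_one (toUnit W)] at h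
    exact (cancel_epi _).1 h
  refine Prod.ext (key (z := x ≫ fst _ _) ?_) (key (z := x ≫ snd _ _) ?_)
  · simpa [translationPair] using congr($h ≫ fst _ _)
  · simpa [translationPair] using congr($h ≫ snd _ _)

lemma eq_of_comp_translationPair_eq_comp_negation {W : Over (Spec (.of k))} [Epi (toUnit W)]
    {x : W ⟶ E ⊗ E} {g h : RationalPoints E × RationalPoints E}
    (hg : x ≫ translationPair E g = x ≫ negation E)
    (hh : x ≫ translationPair E h = x ≫ negation E) : g = h := by
  have key {a b : RationalPoints E} {z : W ⟶ E}
      (h : z ≫ translation E a = z ≫ translation E b) : a = b := by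
    rw [comp_translation, comp_translation, mul_left_inj] at h
    exact (cancel_epi _).1 h
  replace hg := hg.trans hh.symm
  refine Prod.ext (key (z := x ≫ fst _ _) ?_) (key (z := x ≫ snd _ _) ?_)
  · simpa [translationPair] using congr($hg ≫ fst _ _)
  · simpa [translationPair] using congr($hg ≫ snd _ _)

end translationPair

/-- The number of rational points of the Kummer surface of `E × E` is divisible by `8`, for a
proper commutative group scheme `E` over a finite field with full level-`2` structure. -/
lemma eight_dvd_card [Finite k] (E : Over (Spec (.of k))) [GrpObj E] [IsCommMonObj E]
    [IsProper E.hom] (hE : HasFullLevelTwoStructure E) (K : Over (Spec (.of k)))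
    (hK : IsKummerSurface E K) :
    Finite (RationalPoints K) ∧ 8 ∣ Nat.card (RationalPoints K) := by
  obtain ⟨K₀, q, π, hq, hπ⟩ := hK
  obtain ⟨f, hf, hf'⟩ := hE
  have hqw : q.left ≫ K₀.hom = (E ⊗ E).hom := Over.w q
  have hπw : π.left ≫ K₀.hom = K.hom := Over.w π
  have hEE := isProper_tensorObj E
  have hfin : Finite (RationalPoints K) := by
    have h₁ : IsProper (q.left ≫ K₀.hom) := by rwa [hqw]
    have h₂ : LocallyOfFiniteType K₀.hom := hq.locallyOfFiniteType K₀.hom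
    have h₃ : QuasiCompact K₀.hom := hq.quasiCompact K₀.hom
    have h₄ : IsProper π.left := hπ.isProper
    have h₅ : LocallyOfFiniteType K.hom := by rw [← hπw]; infer_instance
    have h₆ : QuasiCompact K.hom := by rw [← hπw]; infer_instance
    exact finite_rationalPoints K
  refine ⟨hfin, ?_⟩
  let G := Multiplicative (ZMod 2 × ZMod 2) × Multiplicative (ZMod 2 × ZMod 2)
  let F : G →* RationalPoints E × RationalPoints E := f.prodMap f
  have hF : Function.Injective F := hf.prodMap hf
  have hF' (g : G) : F g * F g = 1 :=
    Prod.ext ((hf' _).1 ⟨g.1, rfl⟩) ((hf' _).1 ⟨g.2, rfl⟩)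
  have hG : Nat.card G = 16 := by
    simp [G]
  obtain ⟨T₀, T', hT₀, hT', T'_one, T'_mul⟩ := exists_lift_action hq hπ
    (fun g : G ↦ (translationPair E (F g)).left) (by rw [map_one, translationPair_one]; rfl)
    (fun g h ↦ by rw [map_mul, translationPair_mul]; rfl)
    (fun g ↦ congr(($(negation_comp_translationPair (hF' g))).left))
  have := hq.epi
  have hT₀w (g : G) : T₀ g ≫ K₀.hom = K₀.hom := by
    rw [← cancel_epi q.left, reassoc_of% hT₀, hqw]
    exact Over.w _
  have hT'w (g : G) : T' g ≫ K.hom = K.hom := by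
    rw [← hπw, reassoc_of% hT', hT₀w]
  let _ : MulAction G (RationalPoints K) :=
    { smul := fun g s ↦ s ≫ Over.homMk (T' g) (hT'w g)
      one_smul := fun s ↦ by
        ext1
        change s.left ≫ T' 1 = s.left
        rw [T'_one, Category.comp_id]
      mul_smul := fun g h s ↦ by
        ext1
        change s.left ≫ T' (g * h) = (s.left ≫ T' h) ≫ T' g
        -- Postcomposition is a right action; it is a left action because `G` is commutative.
        rw [mul_comm g, T'_mul, Category.assoc] }
  refine MulAction.dvd_natCard_of_forall_orbit (G := G) fun s ↦
    MulAction.eight_dvd_natCard_orbit hG s ?_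
  obtain ⟨L, _, t, x, hx⟩ := hq.exists_over (s ≫ π)
  have key (g : MulAction.stabilizer G s) : x ≫ translationPair E (F g) = x ∨
      x ≫ translationPair E (F g) = x ≫ negation E := by
    have h₁ : s.left ≫ T' g = s.left := congr(($(MulAction.mem_stabilizer_iff.1 g.2)).left)
    have hx' : x.left ≫ q.left = (toUnit (Over.mk t)).left ≫ s.left ≫ π.left :=
      congr(($hx).left)
    have h₂ : x.left ≫ q.left = (x ≫ translationPair E (F g)).left ≫ q.left := by
      rw [Over.comp_left, Category.assoc, ← hT₀, reassoc_of% hx', ← hT', reassoc_of% h₁, hx']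
    exact (hq.eq_or_eq_comp h₂).imp (fun h ↦ Over.OverMorphism.ext h)
      (fun h ↦ Over.OverMorphism.ext h)
  classical
  -- The stabilizer embeds in `Bool` by recording which alternative of `key` holds.
  refine (Nat.card_le_card_of_injective
    (fun g : MulAction.stabilizer G s ↦ decide (x ≫ translationPair E (F g) = x))
    fun g h hgh ↦ ?_).trans_eq (by simp)
  have hgh' : x ≫ translationPair E (F g) = x ↔ x ≫ translationPair E (F h) = x := by
    simpa using hgh
  refine Subtype.ext (hF ?_)
  by_cases hg : x ≫ translationPair E (F g) = x
  · rw [eq_one_of_comp_translationPair_eq hg, eq_one_of_comp_translationPair_eq (hgh'.1 hg)]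
  · exact eq_of_comp_translationPair_eq_comp_negation ((key g).resolve_left hg)
      ((key h).resolve_left fun e ↦ hg (hgh'.2 e))

end KummerSurface

theorem lemma2p31 (p : ℕ) [Fact p.Prime] (hp : 2 < p)
    (E : Over (Spec (.of (ZMod p)))) [GrpObj E] [KummerSurface.IsEllipticCurve E]
    (hE : KummerSurface.HasFullLevelTwoStructure E)
    (K : Over (Spec (.of (ZMod p)))) (hK : KummerSurface.IsKummerSurface E K) :
    Finite (KummerSurface.RationalPoints K) ∧ 8 ∣ Nat.card (KummerSurface.RationalPoints K) := by
  have := KummerSurface.IsEllipticCurve.isProper (E := E)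
  have := KummerSurface.IsEllipticCurve.geometricallyIntegral (E := E)
  -- Proper geometrically integral group schemes over a field are commutative.
  have := isCommMonObj_of_isProper_of_geometricallyIntegral E
  exact KummerSurface.eight_dvd_card E hE K hK
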